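/- Let $A$ be a closed, densely defined, symmetric operator in a complex Hilbert space $\mathcal H$, let $T\subset A^*$ be a linear operator with $\overline T=A^*$, and let $\{\mathcal G,\Gamma_0,\Gamma_1\}$ be a quasi boundary triple for $T$, that is, $\mathcal G$ is a Hilbert space and $\Gamma_0,\Gamma_1:\operatorname{dom}T\to\mathcal G$ are linear maps such that $(Tf,g)-(f,Tg)=(\Gamma_1f,\Gamma_0g)-(\Gamma_0f,\Gamma_1g)$ for all $f,g\in\operatorname{dom}T$, the map $(\Gamma_0,\Gamma_1)$ has dense range in $\mathcal G\times\mathcal G$, and $A_0=T\upharpoonright\ker\Gamma_0$ is self-adjoint. Assume that $A_1=T\upharpoonright\ker\Gamma_1$ is self-adjoint, that $\rho(A_0)\cap\mathbb R\neq\emptyset$, and that $\mathscr G_0=\operatorname{ran}(\Gamma_0\upharpoonright\ker\Gamma_1)$ and $\mathscr G_1=\operatorname{ran}(\Gamma_1\upharpoonright\ker\Gamma_0)$ are dense in $\mathcal G$. Equip $\mathscr G_1$ (respectively $\mathscr G_0$) with a norm which makes it a reflexive Banach space continuously embedded in $\mathcal G$ and such that $\Gamma_1(A_0-\bar\mu)^{-1}:\mathcal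 H\to\mathscr G_1$ is continuous for some $\mu\in\rho(A_0)$ (respectively $\Gamma_0(A_1-\bar\mu)^{-1}:\mathcal H\to\mathscr G_0$ is continuous for some $\mu\in\rho(A_1)$). Let $\mathscr G_j'$ be the anti-dual space of $\mathscr G_j$, so that $\mathscr G_j\subset\mathcal G\subset\mathscr G_j'$, and let $\iota_+:\mathscr G_1\to\mathcal G$ and $\iota_-:\mathscr G_1'\to\mathcal G$ be isomorphisms (linear homeomorphisms) with $(\iota_-x',\iota_+x)_{\mathcal G}=\langle x',x\rangle_{\mathscr G_1'\times\mathscr G_1}$ for all $x\in\mathscr G_1$, $x'\in\mathscr G_1'$. Then $\Gamma_0$ and $\Gamma_1$ have unique extensions $\widetilde\Gamma_0:\operatorname{dom}A^*\to\mathscr G_1'$ and $\widetilde\Gamma_1:\operatorname{dom}A^*\to\mathscr G_0'$ which are linear and continuous with respect to the graph norm of $A^*$. Put $\widetilde\Gamma=(\widetilde\Gamma_0,\widetilde\Gamma_1)$ and, for $\lambda\in\rho(A_0)$, $\widetilde\gamma(\lambda)=(\widetilde\Gamma_0\upharpoonright\ker(A^*-\lambda))^{-1}$ and $\widetilde M(\lambda)=\widetilde\Gamma_1\widetilde\gamma(\lambda)$;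 let $\widetilde\gamma(\lambda)':\mathcal H\to\mathscr G_1$ be the adjoint of $\widetilde\gamma(\lambda):\mathscr G_1'\to\mathcal H$. Let $\vartheta\subset\mathscr G_1'\times\mathscr G_0'$ be a linear relation contained in $\operatorname{ran}\widetilde\Gamma$ such that $\widetilde A_\vartheta=A^*\upharpoonright\{f\in\operatorname{dom}A^*:\widetilde\Gamma f\in\vartheta\}$ is closed. Operators are identified with their graphs, and sums, products and inverses are understood in the sense of linear relations. For a linear relation $\Theta$ in a Hilbert space, $\mu\in\rho(\Theta)$ means that $(\Theta-\mu)^{-1}$ is an everywhere defined bounded operator; $\mu\in\sigma_p(\Theta)$ means $\ker(\Theta-\mu)\ne\{0\}$; $\mu\in\sigma_c(\Theta)$ means that $\ker(\Theta-\mu)=\{0\}$, $\operatorname{ran}(\Theta-\mu)$ is dense and $\mu\notin\rho(\Theta)$; $\mu\in\sigma_r(\Theta)$ means that $\ker(\Theta-\mu)=\{0\}$ and $\operatorname{ran}(\Theta-\mu)$ is not dense. Then for all $\lambda\in\rho(A_0)$: (i) $\lambda\in\sigma_p(\widetilde A_\vartheta)$ if and only if $0\in\sigma_p(\iota_+(\vartheta-\widetilde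 M(\lambda))\iota_-^{-1})$, and in this case $\ker(\widetilde A_\vartheta-\lambda)=\widetilde\gamma(\lambda)\ker(\vartheta-\widetilde M(\lambda))$; (ii) $\lambda\in\sigma_c(\widetilde A_\vartheta)$ if and only if $0\in\sigma_c(\iota_+(\vartheta-\widetilde M(\lambda))\iota_-^{-1})$; (iii) $\lambda\in\sigma_r(\widetilde A_\vartheta)$ if and only if $0\in\sigma_r(\iota_+(\vartheta-\widetilde M(\lambda))\iota_-^{-1})$; (iv) $\lambda\in\rho(\widetilde A_\vartheta)$ if and only if $0\in\rho(\iota_+(\vartheta-\widetilde M(\lambda))\iota_-^{-1})$, and $$(\widetilde A_\vartheta-\lambda)^{-1}=(A_0-\lambda)^{-1}+\widetilde\gamma(\lambda)\bigl(\vartheta-\widetilde M(\lambda)\bigr)^{-1}\widetilde\gamma(\bar\lambda)'$$ holds for all $\lambda\in\rho(\widetilde A_\vartheta)\cap\rho(A_0)$. (In $\iota_+(\vartheta-\widetilde M(\lambda))\iota_-^{-1}$ and in $(\vartheta-\widetilde M(\lambda))^{-1}$ the relation $\vartheta-\widetilde M(\lambda)$ is regarded as a relation from $\mathscr G_1'$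 to $\mathscr G_1\subset\mathscr G_0'$.) -/

import Mathlib

/-! Linear relations: linear subspaces of a product `X × Y`. Operators are identified with their
graphs. -/

namespace LinRel

variable {X Y Z : Type*} [AddCommGroup X] [Module ℂ X] [AddCommGroup Y] [Module ℂ Y]
  [AddCommGroup Z] [Module ℂ Z]

/-- The kernel `{x | (x, 0) ∈ R}`. -/
def ker (R : Submodule ℂ (X × Y)) : Submodule ℂ X :=
  R.comap (LinearMap.inl ℂ X Y)

/-- The range `{y | ∃ x, (x, y) ∈ R}`. -/
def ran (R : Submodule ℂ (X × Y)) : Submodule ℂ Y :=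
  R.map (LinearMap.snd ℂ X Y)

/-- The inverse relation `{(y, x) | (x, y) ∈ R}`. -/
def inv (R : Submodule ℂ (X × Y)) : Submodule ℂ (Y × X) where
  carrier := {p | (p.2, p.1) ∈ R}
  add_mem' {p q} hp hq := by simpa using R.add_mem hp hq
  zero_mem' := R.zero_mem
  smul_mem' c p hp := by simpa using R.smul_mem c hp

/-- The sum `{(x, y + y') | (x, y) ∈ R, (x, y') ∈ S}`. -/
def add (R S : Submodule ℂ (X × Y)) : Submodule ℂ (X × Y) where
  carrier := {p | ∃ y y' : Y, (p.1, y) ∈ R ∧ (p.1, y') ∈ S ∧ p.2 = y + y'}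
  add_mem' := by
    rintro p q ⟨y, y', h1, h2, h3⟩ ⟨w, w', k1, k2, k3⟩
    refine ⟨y + w, y' + w', by simpa using R.add_mem h1 k1, by simpa using S.add_mem h2 k2, ?_⟩
    simp only [Prod.snd_add, h3, k3]
    abel
  zero_mem' := ⟨0, 0, R.zero_mem, S.zero_mem, by simp⟩
  smul_mem' := by
    rintro c p ⟨y, y', h1, h2, h3⟩
    refine ⟨c • y, c • y', by simpa using R.smul_mem c h1, by simpa using S.smul_mem c h2, ?_⟩
    simp [h3]

/-- The difference `{(x, y - y') | (x, y) ∈ R, (x, y') ∈ S}`. -/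
def sub (R S : Submodule ℂ (X × Y)) : Submodule ℂ (X × Y) where
  carrier := {p | ∃ y y' : Y, (p.1, y) ∈ R ∧ (p.1, y') ∈ S ∧ p.2 = y - y'}
  add_mem' := by
    rintro p q ⟨y, y', h1, h2, h3⟩ ⟨w, w', k1, k2, k3⟩
    refine ⟨y + w, y' + w', by simpa using R.add_mem h1 k1, by simpa using S.add_mem h2 k2, ?_⟩
    simp only [Prod.snd_add, h3, k3]
    abel
  zero_mem' := ⟨0, 0, R.zero_mem, S.zero_mem, by simp⟩
  smul_mem' := by
    rintro c p ⟨y, y', h1, h2, h3⟩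
    refine ⟨c • y, c • y', by simpa using R.smul_mem c h1, by simpa using S.smul_mem c h2, ?_⟩
    simp [h3, smul_sub]

/-- The product `S R = {(x, z) | ∃ y, (x, y) ∈ R, (y, z) ∈ S}` (first `R`, then `S`). -/
def comp (S : Submodule ℂ (Y × Z)) (R : Submodule ℂ (X × Y)) : Submodule ℂ (X × Z) where
  carrier := {p | ∃ y : Y, (p.1, y) ∈ R ∧ (y, p.2) ∈ S}
  add_mem' := by
    rintro p q ⟨y, h1, h2⟩ ⟨w, k1, k2⟩
    exact ⟨y + w, by simpa using R.add_mem h1 k1, by simpa using S.add_mem h2 k2⟩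
  zero_mem' := ⟨0, R.zero_mem, S.zero_mem⟩
  smul_mem' := by
    rintro c p ⟨y, h1, h2⟩
    exact ⟨c • y, by simpa using R.smul_mem c h1, by simpa using S.smul_mem c h2⟩

/-- The image `R N = {y | ∃ x ∈ N, (x, y) ∈ R}` of a subspace `N` under a relation `R`. -/
def image (R : Submodule ℂ (X × Y)) (N : Submodule ℂ X) : Submodule ℂ Y :=
  (R ⊓ N.comap (LinearMap.fst ℂ X Y)).map (LinearMap.snd ℂ X Y)

/-- The relation `R - z = {(x, x' - z x) | (x, x') ∈ R}` in `X`, for a scalar `z`. -/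
def subScalar (R : Submodule ℂ (X × X)) (z : ℂ) : Submodule ℂ (X × X) :=
  sub R (LinearMap.graph (z • (LinearMap.id : X →ₗ[ℂ] X)))

end LinRel

namespace LinRel

variable {X : Type*} [NormedAddCommGroup X] [NormedSpace ℂ X]

/-- The resolvent set: `(R - z)⁻¹` is (the graph of) a bounded operator defined on all of `X`. -/
def resolventSet (R : Submodule ℂ (X × X)) : Set ℂ :=
  {z | ∃ B : X →L[ℂ] X, inv (subScalar R z) = LinearMap.graph (B : X →ₗ[ℂ] X)}

/-- The point spectrum. -/
def pointSpectrum (R : Submodule ℂ (X × X)) : Set ℂ :=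
  {z | ker (subScalar R z) ≠ ⊥}

/-- The continuous spectrum. -/
def continuousSpectrum (R : Submodule ℂ (X × X)) : Set ℂ :=
  {z | ker (subScalar R z) = ⊥ ∧ Dense (ran (subScalar R z) : Set X) ∧ z ∉ resolventSet R}

/-- The residual spectrum. -/
def residualSpectrum (R : Submodule ℂ (X × X)) : Set ℂ :=
  {z | ker (subScalar R z) = ⊥ ∧ ¬ Dense (ran (subScalar R z) : Set X)}

end LinRel

namespace QBT

/-- The anti-dual space: continuous conjugate-linear functionals with the operator norm. The
pairing `⟨x', x⟩` of `x'` in the anti-dual with `x` in `X` is `x' x`. -/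
abbrev AntiDual (X : Type*) [NormedAddCommGroup X] [NormedSpace ℂ X] : Type _ := X →L⋆[ℂ] ℂ

section Basic

variable {H : Type*} [NormedAddCommGroup H] [InnerProductSpace ℂ H]
variable {G : Type*} [NormedAddCommGroup G] [InnerProductSpace ℂ G]
variable {X : Type*} [NormedAddCommGroup X] [NormedSpace ℂ X]

/-- The restriction `T ↾ ker Γ` for a linear map `Γ` on the domain of `T`. -/
noncomputable def kerRestrict (T : H →ₗ.[ℂ] H) (Γ : T.domain →ₗ[ℂ] G) : H →ₗ.[ℂ] H :=
  T.domRestrict ((LinearMap.ker Γ).map T.domain.subtype)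

/-- The space `ran (Δ ↾ ker Γ)`. The space `𝒢₁` is `ranOnKer Γ₁ Γ₀` and `𝒢₀` is
`ranOnKer Γ₀ Γ₁`. -/
def ranOnKer {T : H →ₗ.[ℂ] H} (Δ Γ : T.domain →ₗ[ℂ] G) : Submodule ℂ G :=
  (LinearMap.ker Γ).map Δ

/-- The defect subspace `ker (S - z)`, as a subspace of the domain of `S`. -/
def defect (S : H →ₗ.[ℂ] H) (z : ℂ) : Submodule ℂ S.domain :=
  LinearMap.ker (S.toFun - z • S.domain.subtype)

/-- `(G, Γ₀, Γ₁)` is a quasi boundary triple for `T ⊆ A*`. Mathlib's inner product is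
conjugate-linear in the first argument, so `(x, y)` of the mathematical text, linear in `x`,
is `inner ℂ y x`. -/
structure IsQuasiBoundaryTriple [CompleteSpace H] (A T : H →ₗ.[ℂ] H)
    (Γ₀ Γ₁ : T.domain →ₗ[ℂ] G) : Prop where
  /-- `T ⊆ A*` and the closure of `T` is `A*` -/
  closure_eq : T.graph.topologicalClosure = A.adjoint.graph
  /-- the abstract Green identity -/
  green : ∀ f g : T.domain,
    inner ℂ (g : H) (T f) - inner ℂ (T g) (f : H)
      = inner ℂ (Γ₀ g) (Γ₁ f) - inner ℂ (Γ₁ g) (Γ₀ f)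
  /-- `Γ = (Γ₀, Γ₁)` has dense range in `G × G` -/
  denseRange : DenseRange (fun f : T.domain => (Γ₀ f, Γ₁ f))
  /-- `A₀ = T ↾ ker Γ₀` is self-adjoint -/
  selfAdjoint : IsSelfAdjoint (kerRestrict T Γ₀)

/-- The Banach space `X`, embedded in `G` by `j`, is the subspace `ran (Δ ↾ ker Γ)` of `G` with a
norm which makes it a reflexive Banach space continuously embedded in `G`, such that
`Δ (B - z̄)⁻¹`, where `B = T ↾ ker Γ`, is continuous from `H` to `X` for some `z ∈ ρ(B)`. -/
structure IsAdmissibleNorm {T : H →ₗ.[ℂ] H} (Δ Γ : T.domain →ₗ[ℂ] G) (j : X →L[ℂ] G) : Prop where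
  injective : Function.Injective j
  range_eq : LinearMap.range (j : X →ₗ[ℂ] G) = ranOnKer Δ Γ
  complete : CompleteSpace X
  reflexive : Function.Surjective (NormedSpace.inclusionInDoubleDual ℂ X)
  continuous : ∃ z ∈ LinRel.resolventSet (kerRestrict T Γ).graph, ∃ S : H →L[ℂ] X,
    ∀ f : T.domain, Γ f = 0 → j (S (T f - starRingEnd ℂ z • (f : H))) = Δ f

/-- The embedding `G ↪ X'`, `g ↦ (x ↦ (g, x)_G)`, for `X` embedded in `G` by `j`. -/
noncomputable def toAntiDual (j : X →L[ℂ] G) : G →ₗ[ℂ] AntiDual X where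
  toFun g := ((innerSL ℂ (E := G)).flip g).comp j
  map_add' g h := by ext x; simp
  map_smul' c g := by ext x; simp

/-- `F`, defined on the domain of `A*`, is an extension of `Γ`, defined on the domain of `T`, to a
map into the anti-dual of `X`, which is continuous for the graph norm of `A*`. -/
structure IsContinuousExtension [CompleteSpace H] (A : H →ₗ.[ℂ] H) {T : H →ₗ.[ℂ] H}
    (Γ : T.domain →ₗ[ℂ] G) (j : X →L[ℂ] G) (F : A.adjoint.domain →ₗ[ℂ] AntiDual X) : Prop where
  extends_map : ∀ (f : T.domain) (g : A.adjoint.domain), (f : H) = g → F g = toAntiDual j (Γ f)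
  continuous : ∃ c : ℝ, ∀ f : A.adjoint.domain, ‖F f‖ ≤ c * (‖(f : H)‖ + ‖A.adjoint f‖)

open Classical in
/-- The continuous extension `Γ̃ : dom A* → X'` of `Γ` (and `0` should there be none). -/
noncomputable def extendedMap [CompleteSpace H] (A : H →ₗ.[ℂ] H) {T : H →ₗ.[ℂ] H}
    (Γ : T.domain →ₗ[ℂ] G) (j : X →L[ℂ] G) : A.adjoint.domain →ₗ[ℂ] AntiDual X :=
  if h : ∃ F, IsContinuousExtension A Γ j F then h.choose else 0

end Basic

section Extended

variable {H : Type*} [NormedAddCommGroup H] [InnerProductSpace ℂ H]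
variable {G : Type*} [NormedAddCommGroup G] [InnerProductSpace ℂ G]
variable {X₀ : Type*} [NormedAddCommGroup X₀] [NormedSpace ℂ X₀]
variable {X₁ : Type*} [NormedAddCommGroup X₁] [NormedSpace ℂ X₁]

/-- The restriction `S ↾ {f ∈ dom S | (Γt₀ f, Γt₁ f) ∈ ϑ}`. -/
noncomputable def extension (S : H →ₗ.[ℂ] H) (Γt₀ : S.domain →ₗ[ℂ] AntiDual X₁)
    (Γt₁ : S.domain →ₗ[ℂ] AntiDual X₀) (ϑ : Submodule ℂ (AntiDual X₁ × AntiDual X₀)) :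
    H →ₗ.[ℂ] H :=
  S.domRestrict ((ϑ.comap (Γt₀.prod Γt₁)).map S.domain.subtype)

/-- The extended `γ`-field `γ̃(z) = (Γt₀ ↾ ker (S - z))⁻¹ = {(Γt₀ f, f) | f ∈ ker (S - z)}`. -/
noncomputable def gammaField (S : H →ₗ.[ℂ] H) (Γt₀ : S.domain →ₗ[ℂ] AntiDual X₁) (z : ℂ) :
    Submodule ℂ (AntiDual X₁ × H) :=
  (defect S z).map (Γt₀.prod S.domain.subtype)

/-- The extended Weyl function `M̃(z) = Γt₁ γ̃(z) = {(Γt₀ f, Γt₁ f) | f ∈ ker (S - z)}`. -/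
noncomputable def weylFunction (S : H →ₗ.[ℂ] H) (Γt₀ : S.domain →ₗ[ℂ] AntiDual X₁)
    (Γt₁ : S.domain →ₗ[ℂ] AntiDual X₀) (z : ℂ) : Submodule ℂ (AntiDual X₁ × AntiDual X₀) :=
  (defect S z).map (Γt₀.prod Γt₁)

/-- The adjoint `R' : H → X₁` of an operator `R : X₁' → H`, determined by
`⟨x', R' h⟩ = (R x', h)_H` for all `x'`; as a relation it consists of the pairs `(h, x)` with
`⟨x', x⟩ = (f, h)_H` for all `(x', f) ∈ R`. -/
def adj (R : Submodule ℂ (AntiDual X₁ × H)) : Submodule ℂ (H × X₁) where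
  carrier := {p | ∀ q ∈ R, q.1 p.2 = inner ℂ p.1 q.2}
  add_mem' {p q} hp hq := by
    intro r hr
    simp [hp r hr, hq r hr]
  zero_mem' := by intro r _; simp
  smul_mem' c p hp := by
    intro r hr
    simp [hp r hr, mul_comm]

/-- A relation `R ⊆ X₁' × X₀'` regarded as a relation from `X₁'` to `X₁`, where `X₁` (embedded in
`G` by `j₁`) is viewed inside `X₀'` by means of `X₁ ↪ G ↪ X₀'`: the pairs `(x', x)` in
`X₁' × X₁` which belong to `R`. -/
noncomputable def toRegular (j₀ : X₀ →L[ℂ] G) (j₁ : X₁ →L[ℂ] G)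
    (R : Submodule ℂ (AntiDual X₁ × AntiDual X₀)) : Submodule ℂ (AntiDual X₁ × X₁) :=
  R.comap (LinearMap.id.prodMap ((toAntiDual j₀).comp (j₁ : X₁ →ₗ[ℂ] G)))

/-- The relation `ι₊ R ι₋⁻¹` in `G`, for a relation `R` from `X₁'` to `X₁`. -/
noncomputable def conjugate (ιp : X₁ ≃L[ℂ] G) (ιm : AntiDual X₁ ≃L[ℂ] G)
    (R : Submodule ℂ (AntiDual X₁ × X₁)) : Submodule ℂ (G × G) :=
  LinRel.comp (LinearMap.graph (ιp.toLinearEquiv : X₁ →ₗ[ℂ] G))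
    (LinRel.comp R (LinRel.inv (LinearMap.graph (ιm.toLinearEquiv : AntiDual X₁ →ₗ[ℂ] G))))

end Extended

end QBT

/-! Fix `z ∈ ρ(A₀)` and put `R = (A₀ - z)⁻¹`, `S = Γ₁ R : H → 𝒢₁`. The operator `S` is bounded and
onto, and `γ = γ̃(z)` is the adjoint of the corresponding operator at `z̄`. Since `ker Γ̃₀ = dom
A₀`, every `f ∈ dom A*` splits as `f = R (A* - z) f + γ Γ̃₀ f`, and applying `Γ̃₁` gives `Γ̃₁ f =
M̃(z) Γ̃₀ f + S (A* - z) f`. Hence `ϑ - M̃(z)`, read with values in `𝒢₁`, consists of the pairs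
`(Γ̃₀ f, S (A* - z) f)` with `Γ̃ f ∈ ϑ`, and `(f, h) ∈ Ã_ϑ - z` exactly when `f = R h + γ x'` for
some `(x', S h) ∈ ϑ - M̃(z)`. This equivalence, `IsGammaPair.mem_subScalar_extension`, is Krein's
formula for relations and yields all four claims: `S` has a bounded right inverse and `γ` a bounded
left inverse, so kernel, density of the range and bounded invertibility pass between the two sides.

The extensions come from Green's identity: for `x = Γ₁ g` with `Γ₀ g = 0`, the value `⟨Γ̃₀ f, x⟩`
must be `(f, T g) - (A* f, g)`, and a right inverse of `S` selects `g` continuously in `x`. The map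
`Γ̃₁` is obtained with the roles exchanged. Uniqueness is graph-norm density of `dom T` in `dom A*`.
-/

namespace LinRel

/-! ### Elementwise descriptions of linear relations. -/

section Algebra

variable {X : Type*} [AddCommGroup X] [Module ℂ X]

theorem mem_subScalar {R : Submodule ℂ (X × X)} {z : ℂ} {x y : X} :
    (x, y) ∈ subScalar R z ↔ (x, y + z • x) ∈ R := by
  constructor
  · rintro ⟨a, b, ha, hb, hab⟩
    obtain rfl : b = z • x := hb
    obtain rfl : y = a - z • x := hab
    simpa using ha
  · intro h
    exact ⟨y + z • x, z • x, h, rfl, by simp⟩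

theorem mem_ran {Y : Type*} [AddCommGroup Y] [Module ℂ Y] {R : Submodule ℂ (X × Y)} {y : Y} :
    y ∈ ran R ↔ ∃ x, (x, y) ∈ R := by
  simp [ran]

theorem ker_eq_bot_iff {Y : Type*} [AddCommGroup Y] [Module ℂ Y] {R : Submodule ℂ (X × Y)} :
    ker R = ⊥ ↔ ∀ x, (x, 0) ∈ R → x = 0 :=
  Submodule.eq_bot_iff _

theorem inv_eq_graph_iff {Y : Type*} [AddCommGroup Y] [Module ℂ Y] {R : Submodule ℂ (X × Y)}
    {B : Y →ₗ[ℂ] X} : inv R = LinearMap.graph B ↔ ∀ x y, (x, y) ∈ R ↔ x = B y := by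
  constructor
  · intro h x y
    exact (SetLike.ext_iff.1 h (y, x)).trans (LinearMap.mem_graph_iff _ _)
  · intro h
    ext ⟨y, x⟩
    exact (h x y).trans (LinearMap.mem_graph_iff B (y, x)).symm

end Algebra

/-! If `L = {(R h + γ a, h) | (a, S h) ∈ K}` with `S` and `γ` bounded, `S` right invertible and `γ`
left invertible, then `L` and `K` have the same spectral properties at `0`. -/

section Transfer

variable {H G : Type*} [NormedAddCommGroup H] [NormedSpace ℂ H] [NormedAddCommGroup G]
  [NormedSpace ℂ G] {L : Submodule ℂ (H × H)} {K : Submodule ℂ (G × G)} {R : H →L[ℂ] H}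
  {γ : G →L[ℂ] H} {S : H →L[ℂ] G}

/-- At `h = 0` the hypothesis reads `ker L = γ (ker K)`. -/
theorem ker_eq_bot_iff_of_krein (hL : ∀ f h, (f, h) ∈ L ↔ ∃ a, (a, S h) ∈ K ∧ f = R h + γ a)
    (hγ : Function.Injective γ) : ker L = ⊥ ↔ ker K = ⊥ := by
  simp only [ker_eq_bot_iff, hL, map_zero, zero_add]
  constructor
  · intro h a ha
    exact hγ ((h _ ⟨a, ha, rfl⟩).trans (map_zero γ).symm)
  · rintro h f ⟨a, ha, rfl⟩
    rw [h a ha, map_zero]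

/-- The range of `L` is the preimage under `S` of the range of `K`, and `S` is a continuous open
surjection. -/
theorem dense_ran_iff_of_krein (hL : ∀ f h, (f, h) ∈ L ↔ ∃ a, (a, S h) ∈ K ∧ f = R h + γ a)
    {S' : G →L[ℂ] H} (hS : ∀ a, S (S' a) = a) :
    Dense (ran L : Set H) ↔ Dense (ran K : Set G) := by
  have hran : (ran L : Set H) = S ⁻¹' (ran K : Set G) := by
    ext h
    simp only [SetLike.mem_coe, Set.mem_preimage, mem_ran, hL]
    exact ⟨fun ⟨_, a, ha, _⟩ => ⟨a, ha⟩, fun ⟨a, ha⟩ => ⟨_, a, ha, rfl⟩⟩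
  have hsurj : Function.Surjective S := fun a => ⟨_, hS a⟩
  have hopen : IsOpenMap S := by
    intro U hU
    rw [isOpen_iff_mem_nhds]
    rintro _ ⟨u, hu, rfl⟩
    -- A preimage of `a` under `S` that depends continuously on `a` and equals `u` at `a = S u`.
    have hc : Continuous fun a => u + S' (a - S u) := by fun_prop
    filter_upwards [hc.continuousAt.preimage_mem_nhds (x := S u)
      (hU.mem_nhds (by simpa using hu))] with a ha
    exact ⟨_, ha, by simp [hS]⟩
  rw [hran]
  refine ⟨fun h => ?_, fun h => h.preimage hopen⟩
  have := hsurj.denseRange.dense_image S.continuous h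
  rwa [Set.image_preimage_eq _ hsurj] at this

/-- The bounded inverses determine each other: `L⁻¹ = R + γ K⁻¹ S` and `K⁻¹ = δ (L⁻¹ - R) S'`. -/
theorem exists_inv_eq_graph_iff_of_krein
    (hL : ∀ f h, (f, h) ∈ L ↔ ∃ a, (a, S h) ∈ K ∧ f = R h + γ a)
    {S' : G →L[ℂ] H} (hS : ∀ a, S (S' a) = a) {δ : H →L[ℂ] G} (hδ : ∀ a, δ (γ a) = a) :
    (∃ B : H →L[ℂ] H, inv L = LinearMap.graph (B : H →ₗ[ℂ] H)) ↔
      ∃ B : G →L[ℂ] G, inv K = LinearMap.graph (B : G →ₗ[ℂ] G) := by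
  simp only [inv_eq_graph_iff, ContinuousLinearMap.coe_coe]
  constructor
  · rintro ⟨B, hB⟩
    refine ⟨δ ∘L (B - R) ∘L S', fun a b => ?_⟩
    have key : ∀ c, (c, b) ∈ K ↔ B (S' b) = R (S' b) + γ c := by
      intro c
      constructor
      · intro hc
        exact ((hB _ _).1 ((hL _ _).2 ⟨c, by rwa [hS], rfl⟩)).symm
      · intro hc
        obtain ⟨d, hd, hd'⟩ := (hL _ _).1 ((hB _ _).2 hc.symm)
        rw [hS] at hd
        have : γ c = γ d := add_left_cancel hd'
        rwa [← hδ c, this, hδ]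
    obtain ⟨d, hd, hd'⟩ := (hL _ (S' b)).1 ((hB _ _).2 rfl)
    have hBd : δ ((B - R) (S' b)) = d := by
      simp [hd', hδ]
    simp only [ContinuousLinearMap.comp_apply, hBd]
    constructor
    · intro ha
      have := ((key a).1 ha).symm.trans hd'
      rw [← hδ a, add_left_cancel this, hδ]
    · rintro rfl
      exact (key a).2 hd'
  · rintro ⟨Q, hQ⟩
    refine ⟨R + γ ∘L Q ∘L S, fun f h => ?_⟩
    rw [hL]
    simp [hQ]

end Transfer

end LinRel

/-- A continuous linear surjection from a Hilbert space onto a Banach space has a continuous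
right inverse. -/
theorem ContinuousLinearMap.hasRightInverse_of_surjective
    {H : Type*} [NormedAddCommGroup H] [InnerProductSpace ℂ H] [CompleteSpace H]
    {X : Type*} [NormedAddCommGroup X] [NormedSpace ℂ X] [CompleteSpace X]
    {S : H →L[ℂ] X} (hS : Function.Surjective S) : S.HasRightInverse := by
  have hker : IsClosed (LinearMap.ker (S : H →ₗ[ℂ] X) : Set H) := S.isClosed_ker
  have : CompleteSpace (LinearMap.ker (S : H →ₗ[ℂ] X)) := hker.completeSpace_coe
  -- On the orthogonal complement of its kernel `S` is a bijection, so the open mapping theorem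
  -- inverts it.
  let e := ContinuousLinearEquiv.ofBijective
    (S ∘L (LinearMap.ker (S : H →ₗ[ℂ] X))ᗮ.subtypeL) (by
      rw [LinearMap.ker_eq_bot']
      rintro ⟨x, hx⟩ h
      have h0 : inner ℂ x x = 0 := (Submodule.mem_orthogonal _ _).1 hx x h
      exact Subtype.ext (inner_self_eq_zero.1 h0)) (by
      rw [LinearMap.range_eq_top]
      intro y
      obtain ⟨x, rfl⟩ := hS y
      obtain ⟨a, ha, b, hb, rfl⟩ :=
        (LinearMap.ker (S : H →ₗ[ℂ] X)).exists_add_mem_mem_orthogonal x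
      have ha' : S a = 0 := ha
      exact ⟨⟨b, hb⟩, by simp [ha']⟩)
  exact ⟨(LinearMap.ker (S : H →ₗ[ℂ] X))ᗮ.subtypeL ∘L e.symm.toContinuousLinearMap,
    fun y => e.apply_symm_apply y⟩

/-! ### Graphs of restrictions and adjoints of unbounded operators. -/

namespace LinearPMap

variable {H : Type*} [NormedAddCommGroup H] [InnerProductSpace ℂ H]

theorem mem_graph_domRestrict_map {S : H →ₗ.[ℂ] H} {N : Submodule ℂ S.domain} {f h : H} :
    (f, h) ∈ (S.domRestrict (N.map S.domain.subtype)).graph ↔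
      ∃ u : S.domain, u ∈ N ∧ (u : H) = f ∧ S u = h := by
  rw [mem_graph_iff]
  constructor
  · rintro ⟨⟨x, ⟨u, hu, rfl⟩, hx⟩, rfl, rfl⟩
    exact ⟨u, hu, rfl, (domRestrict_apply rfl).symm⟩
  · rintro ⟨u, hu, rfl, rfl⟩
    exact ⟨⟨u, ⟨u, hu, rfl⟩, u.2⟩, rfl, domRestrict_apply rfl⟩

theorem exists_adjoint_apply_eq [CompleteSpace H] {A : H →ₗ.[ℂ] H}
    (hA : Dense (A.domain : Set H)) {f k : H}
    (h : ∀ v : A.domain, inner ℂ k (v : H) = inner ℂ f (A v)) :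
    ∃ u : A.adjoint.domain, (u : H) = f ∧ A.adjoint u = k :=
  ⟨⟨f, mem_adjoint_domain_of_exists f ⟨k, h⟩⟩, rfl, adjoint_apply_eq hA _ h⟩

end LinearPMap

/-! ### Resolvents of `T ↾ ker Γ` and their boundary values. -/

namespace QBT

open LinRel

section Restriction

variable {H : Type*} [NormedAddCommGroup H] [InnerProductSpace ℂ H]
variable {G : Type*} [NormedAddCommGroup G] [InnerProductSpace ℂ G]
variable {T : H →ₗ.[ℂ] H} {Γ Δ : T.domain →ₗ[ℂ] G}

theorem mem_graph_kerRestrict {f h : H} :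
    (f, h) ∈ (kerRestrict T Γ).graph ↔ ∃ u : T.domain, Γ u = 0 ∧ (u : H) = f ∧ T u = h :=
  LinearPMap.mem_graph_domRestrict_map

/-- `R` is the resolvent `(T ↾ ker Γ - z)⁻¹`. -/
def IsResolvent (Γ : T.domain →ₗ[ℂ] G) (z : ℂ) (R : H →L[ℂ] H) : Prop :=
  inv (subScalar (kerRestrict T Γ).graph z) = LinearMap.graph (R : H →ₗ[ℂ] H)

/-- The two conjuncts are the right and the left inverse property. -/
theorem isResolvent_iff {z : ℂ} {R : H →L[ℂ] H} :
    IsResolvent Γ z R ↔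
      (∀ h, ∃ u : T.domain, Γ u = 0 ∧ (u : H) = R h ∧ T u = h + z • R h) ∧
        ∀ u : T.domain, Γ u = 0 → R (T u - z • (u : H)) = u := by
  rw [IsResolvent, inv_eq_graph_iff]
  simp only [mem_subScalar, mem_graph_kerRestrict, ContinuousLinearMap.coe_coe]
  constructor
  · intro hR
    exact ⟨fun h => (hR _ h).2 rfl, fun u hu => ((hR _ _).1 ⟨u, hu, rfl, by simp⟩).symm⟩
  · rintro ⟨h₁, h₂⟩ f h
    constructor
    · rintro ⟨u, hu, rfl, hu'⟩
      rw [← h₂ u hu, hu', add_sub_cancel_right]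
    · rintro rfl
      exact h₁ h

theorem IsResolvent.exists_eq {z : ℂ} {R : H →L[ℂ] H} (hR : IsResolvent Γ z R) (h : H) :
    ∃ u : T.domain, Γ u = 0 ∧ (u : H) = R h ∧ T u = h + z • R h :=
  (isResolvent_iff.1 hR).1 h

theorem IsResolvent.apply {z : ℂ} {R : H →L[ℂ] H} (hR : IsResolvent Γ z R) (u : T.domain)
    (hu : Γ u = 0) : R (T u - z • (u : H)) = u :=
  (isResolvent_iff.1 hR).2 u hu

section SelfAdjoint

variable [CompleteSpace H]

theorem inner_comm_of_isSelfAdjoint (hsa : IsSelfAdjoint (kerRestrict T Γ)) {u v : T.domain}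
    (hu : Γ u = 0) (hv : Γ v = 0) : inner ℂ (T u) (v : H) = inner ℂ (u : H) (T v) := by
  have hf := LinearPMap.adjoint_isFormalAdjoint hsa.dense_domain
  rw [LinearPMap.isSelfAdjoint_def.1 hsa] at hf
  obtain ⟨u', h₁, h₂⟩ := (LinearPMap.mem_graph_iff _).1 (mem_graph_kerRestrict.2 ⟨u, hu, rfl, rfl⟩)
  obtain ⟨v', h₃, h₄⟩ := (LinearPMap.mem_graph_iff _).1 (mem_graph_kerRestrict.2 ⟨v, hv, rfl, rfl⟩)
  simpa only [h₁, h₂, h₃, h₄] using hf u' v'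

/-- The maximality half of self-adjointness; it is the means of showing that a vector lies in `dom
T`. -/
theorem exists_of_isSelfAdjoint (hsa : IsSelfAdjoint (kerRestrict T Γ)) {f k : H}
    (h : ∀ v : T.domain, Γ v = 0 → inner ℂ k (v : H) = inner ℂ f (T v)) :
    ∃ u : T.domain, Γ u = 0 ∧ (u : H) = f ∧ T u = k := by
  obtain ⟨u, hu⟩ := LinearPMap.exists_adjoint_apply_eq hsa.dense_domain (f := f) (k := k) (by
    intro v
    obtain ⟨v', h₁, h₂, h₃⟩ := mem_graph_kerRestrict.1 ((kerRestrict T Γ).mem_graph v)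
    rw [← h₂, ← h₃]
    exact h v' h₁)
  have hmem := (LinearPMap.mem_graph_iff (kerRestrict T Γ).adjoint (x := (f, k))).2 ⟨u, hu⟩
  rw [LinearPMap.isSelfAdjoint_def.1 hsa] at hmem
  exact mem_graph_kerRestrict.1 hmem

open ComplexConjugate in
-- The right inverse property uses maximality of the self-adjoint restriction, the left one only its
-- symmetry.
theorem IsResolvent.adjoint (hsa : IsSelfAdjoint (kerRestrict T Γ)) {z : ℂ} {R : H →L[ℂ] H}
    (hR : IsResolvent Γ z R) : IsResolvent Γ (conj z) R.adjoint := by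
  rw [isResolvent_iff]
  constructor
  · intro h
    refine exists_of_isSelfAdjoint hsa fun v hv => ?_
    have h₁ : inner ℂ h (v : H) = inner ℂ (R.adjoint h) (T v - z • (v : H)) := by
      rw [ContinuousLinearMap.adjoint_inner_left, hR.apply v hv]
    rw [inner_add_left, h₁, inner_sub_right, inner_smul_left, inner_smul_right]
    simp
  · intro u hu
    refine ext_inner_right ℂ fun k => ?_
    obtain ⟨v, hv, hv', hTv⟩ := hR.exists_eq k
    rw [ContinuousLinearMap.adjoint_inner_left, ← hv', inner_sub_left, inner_smul_left,
      inner_comm_of_isSelfAdjoint hsa hu hv, hTv, hv', inner_add_right, inner_smul_right]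
    simp

end SelfAdjoint

section AdmissibleNorm

variable {X : Type*} [NormedAddCommGroup X] [NormedSpace ℂ X] {j : X →L[ℂ] G}

/-- `S` is the operator `Δ (T ↾ ker Γ - z)⁻¹` from `H` to the space `X`, embedded in `G` by `j`. -/
def IsTraceResolvent (Δ Γ : T.domain →ₗ[ℂ] G) (j : X →L[ℂ] G) (z : ℂ) (S : H →L[ℂ] X) : Prop :=
  ∀ u : T.domain, Γ u = 0 → j (S (T u - z • (u : H))) = Δ u

/-- Admissibility gives continuity at one point `w̄` only. With `B = T ↾ ker Γ`, the identity `(B -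
w̄)(B - z)⁻¹ = 1 + (z - w̄)(B - z)⁻¹` carries it to every `z ∈ ρ(B)`. -/
theorem IsAdmissibleNorm.exists_isTraceResolvent (hj : IsAdmissibleNorm Δ Γ j) {z : ℂ}
    {R : H →L[ℂ] H} (hR : IsResolvent Γ z R) : ∃ S : H →L[ℂ] X, IsTraceResolvent Δ Γ j z S := by
  obtain ⟨w, -, S, hS⟩ := hj.continuous
  refine ⟨S ∘L (ContinuousLinearMap.id ℂ H + (z - starRingEnd ℂ w) • R), fun u hu => ?_⟩
  have key : (ContinuousLinearMap.id ℂ H + (z - starRingEnd ℂ w) • R) (T u - z • (u : H)) =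
      T u - starRingEnd ℂ w • (u : H) := by
    change (T u - z • (u : H)) + (z - starRingEnd ℂ w) • R (T u - z • (u : H)) = _
    rw [hR.apply u hu]
    module
  rw [ContinuousLinearMap.comp_apply, key, hS u hu]

theorem IsTraceResolvent.hasRightInverse [CompleteSpace H] (hj : IsAdmissibleNorm Δ Γ j) {z : ℂ}
    {S : H →L[ℂ] X} (hS : IsTraceResolvent Δ Γ j z S) : S.HasRightInverse := by
  have := hj.complete
  refine ContinuousLinearMap.hasRightInverse_of_surjective fun x => ?_
  have hx : j x ∈ ranOnKer Δ Γ := hj.range_eq ▸ ⟨x, rfl⟩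
  obtain ⟨u, hu, hux⟩ := hx
  exact ⟨T u - z • (u : H), hj.injective ((hS u hu).trans hux)⟩

end AdmissibleNorm

end Restriction

end QBT

/-! ### Extension of the boundary maps to `dom A*`. -/

namespace QBT

open LinRel

section ContinuousExtension

variable {H : Type*} [NormedAddCommGroup H] [InnerProductSpace ℂ H] [CompleteSpace H]
variable {G : Type*} [NormedAddCommGroup G] [InnerProductSpace ℂ G]
variable {X : Type*} [NormedAddCommGroup X] [NormedSpace ℂ X]
variable {A T : H →ₗ.[ℂ] H} {Γ Δ : T.domain →ₗ[ℂ] G} {j : X →L[ℂ] G}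

theorem toAntiDual_apply (j : X →L[ℂ] G) (g : G) (x : X) :
    toAntiDual j g x = inner ℂ (j x) g := rfl

theorem toAntiDual_injective (hj : Dense (Set.range j)) : Function.Injective (toAntiDual j) := by
  intro a b hab
  refine hj.eq_of_inner_right ℂ ?_
  rintro _ ⟨x, rfl⟩
  exact DFunLike.congr_fun hab x

theorem exists_adjoint_eq_of_domain (hT : T.graph.topologicalClosure = A.adjoint.graph)
    (u : T.domain) : ∃ v : A.adjoint.domain, (v : H) = u ∧ A.adjoint v = T u := by
  have h : ((u : H), T u) ∈ A.adjoint.graph :=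
    hT ▸ T.graph.le_topologicalClosure (T.mem_graph u)
  exact (LinearPMap.mem_graph_iff _).1 h

/-- Graph-norm density of `dom T` in `dom A*`. -/
theorem eq_zero_of_eq_zero_on_domain {V : Type*} [NormedAddCommGroup V] [Module ℂ V]
    (hT : T.graph.topologicalClosure = A.adjoint.graph) {φ : A.adjoint.domain →ₗ[ℂ] V} {c : ℝ}
    (hφ : ∀ f : A.adjoint.domain, ‖φ f‖ ≤ c * (‖(f : H)‖ + ‖A.adjoint f‖))
    (h0 : ∀ (u : T.domain) (v : A.adjoint.domain), (u : H) = v → φ v = 0) : φ = 0 := by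
  ext f
  rw [LinearMap.zero_apply, ← norm_le_zero_iff]
  refine le_of_forall_pos_le_add fun ε hε => ?_
  -- The factor `2` serves the two components of the graph; `|c| + 1` is positive whatever the sign
  -- of `c`.
  have hc : 0 < 2 * (|c| + 1) := by positivity
  have hf : ((f : H), A.adjoint f) ∈ closure (T.graph : Set (H × H)) := by
    rw [← Submodule.topologicalClosure_coe, hT]
    exact A.adjoint.mem_graph f
  obtain ⟨⟨a, b⟩, hab, hdist⟩ := Metric.mem_closure_iff.1 hf _ (div_pos hε hc)
  obtain ⟨u, rfl, rfl⟩ := (LinearPMap.mem_graph_iff _).1 hab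
  obtain ⟨v, hv, hv'⟩ := exists_adjoint_eq_of_domain hT u
  rw [Prod.dist_eq, max_lt_iff, dist_eq_norm, dist_eq_norm] at hdist
  obtain ⟨h₁, h₂⟩ := hdist
  have hsub : φ f = φ (f - v) := by rw [map_sub, h0 u v hv.symm, sub_zero]
  have hnorm := hφ (f - v)
  rw [← hsub, LinearPMap.map_sub, hv', Submodule.coe_sub, hv] at hnorm
  have h₃ : ‖(f : H) - u‖ + ‖A.adjoint f - T u‖ ≤ ε / (|c| + 1) := by
    have : ε / (|c| + 1) = ε / (2 * (|c| + 1)) + ε / (2 * (|c| + 1)) := by field_simp; ring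
    rw [this]
    exact add_le_add h₁.le h₂.le
  calc ‖φ f‖ ≤ (|c| + 1) * (‖(f : H) - u‖ + ‖A.adjoint f - T u‖) := hnorm.trans <|
        mul_le_mul_of_nonneg_right ((le_abs_self c).trans (by linarith)) (by positivity)
    _ ≤ (|c| + 1) * (ε / (|c| + 1)) := by gcongr
    _ = 0 + ε := by field_simp; ring

/-- The part of the abstract Green identity with `Γ g = 0`; here `s = 1` for `(Γ₀, Γ₁)` and
`s = -1` for `(Γ₁, Γ₀)`. -/
def GreenOnKer (Γ Δ : T.domain →ₗ[ℂ] G) (s : ℂ) : Prop :=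
  ∀ f g : T.domain, Γ g = 0 →
    inner ℂ (Δ g) (Γ f) = s * (inner ℂ (T g) (f : H) - inner ℂ (g : H) (T f))

theorem IsContinuousExtension.unique (hT : T.graph.topologicalClosure = A.adjoint.graph)
    {F F' : A.adjoint.domain →ₗ[ℂ] AntiDual X} (hF : IsContinuousExtension A Γ j F)
    (hF' : IsContinuousExtension A Γ j F') : F = F' := by
  obtain ⟨c, hc⟩ := hF.continuous
  obtain ⟨c', hc'⟩ := hF'.continuous
  refine sub_eq_zero.1 (eq_zero_of_eq_zero_on_domain hT (c := c + c') (fun f => ?_)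
    fun u v huv => ?_)
  · rw [add_mul]
    exact (norm_sub_le _ _).trans (add_le_add (hc f) (hc' f))
  · rw [LinearMap.sub_apply, hF.extends_map u v huv, hF'.extends_map u v huv, sub_self]

/-- Green's identity is taken as the definition of the extension. Its right side needs only `f ∈ dom
A*`, once `x` is written as `Δ g` with `g ∈ ker Γ` depending continuously on `x`. -/
theorem exists_isContinuousExtension (hT : T.graph.topologicalClosure = A.adjoint.graph) {s : ℂ}
    (hG : GreenOnKer Γ Δ s) (hj : IsAdmissibleNorm Δ Γ j) {z : ℂ} {R : H →L[ℂ] H}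
    (hR : IsResolvent Γ z R) :
    ∃ F : A.adjoint.domain →ₗ[ℂ] AntiDual X, IsContinuousExtension A Γ j F := by
  obtain ⟨S, hS⟩ := hj.exists_isTraceResolvent hR
  obtain ⟨S', hS'⟩ := hS.hasRightInverse hj
  -- With `g = R (S' x)` one has `Q x = g`, `P x = T g` and `Δ g = j x`.
  let P : X →L[ℂ] H := S' + z • (R ∘L S')
  let Q : X →L[ℂ] H := R ∘L S'
  let F : A.adjoint.domain →ₗ[ℂ] AntiDual X :=
    { toFun := fun f => s • (((innerSL ℂ (E := H)).flip (f : H)).comp P -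
        ((innerSL ℂ (E := H)).flip (A.adjoint f)).comp Q)
      map_add' := fun f g => by
        ext x
        simp [LinearPMap.map_add]
        ring
      map_smul' := fun a f => by
        ext x
        simp [LinearPMap.map_smul]
        ring }
  have hFapply : ∀ f x, F f x = s * (inner ℂ (P x) (f : H) - inner ℂ (Q x) (A.adjoint f)) :=
    fun f x => rfl
  refine ⟨F, ⟨fun u v huv => ?_, ‖s‖ * (‖P‖ + ‖Q‖), fun f => ?_⟩⟩
  · ext x
    obtain ⟨w, hw, hwR, hTw⟩ := hR.exists_eq (S' x)
    obtain ⟨v', hv', hTv'⟩ := exists_adjoint_eq_of_domain hT u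
    obtain rfl : v' = v := Subtype.ext (hv'.trans huv)
    have hx : j x = Δ w := by
      rw [← hS w hw, hTw, hwR, add_sub_cancel_right, hS']
    have hP : P x = T w := hTw.symm
    have hQ : Q x = w := hwR.symm
    rw [hFapply, toAntiDual_apply, hx, hG u w hw, hP, hQ, hTv', hv']
  · refine ContinuousLinearMap.opNorm_le_bound _ (by positivity) fun x => ?_
    rw [hFapply, norm_mul]
    have h₁ : ‖inner ℂ (P x) (f : H)‖ ≤ ‖P‖ * ‖x‖ * ‖(f : H)‖ :=
      (norm_inner_le_norm _ _).trans (by gcongr; exact P.le_opNorm x)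
    have h₂ : ‖inner ℂ (Q x) (A.adjoint f)‖ ≤ ‖Q‖ * ‖x‖ * ‖A.adjoint f‖ :=
      (norm_inner_le_norm _ _).trans (by gcongr; exact Q.le_opNorm x)
    calc ‖s‖ * ‖inner ℂ (P x) (f : H) - inner ℂ (Q x) (A.adjoint f)‖
        ≤ ‖s‖ * (‖P‖ * ‖x‖ * ‖(f : H)‖ + ‖Q‖ * ‖x‖ * ‖A.adjoint f‖) := by
          gcongr
          exact (norm_sub_le _ _).trans (add_le_add h₁ h₂)
      _ ≤ ‖s‖ * (‖P‖ * ‖x‖ * (‖(f : H)‖ + ‖A.adjoint f‖) +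
            ‖Q‖ * ‖x‖ * (‖(f : H)‖ + ‖A.adjoint f‖)) := by
          gcongr <;> simp
      _ = ‖s‖ * (‖P‖ + ‖Q‖) * (‖(f : H)‖ + ‖A.adjoint f‖) * ‖x‖ := by ring

/-- The Green identity for the extension. -/
theorem IsContinuousExtension.apply_eq (hT : T.graph.topologicalClosure = A.adjoint.graph) {s : ℂ}
    (hG : GreenOnKer Γ Δ s) {F : A.adjoint.domain →ₗ[ℂ] AntiDual X}
    (hF : IsContinuousExtension A Γ j F) {x : X} {g : T.domain} (hg : Γ g = 0) (hx : j x = Δ g)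
    (f : A.adjoint.domain) :
    F f x = s * (inner ℂ (T g) (f : H) - inner ℂ (g : H) (A.adjoint f)) := by
  obtain ⟨c, hc⟩ := hF.continuous
  -- The difference of the two sides is bounded for the graph norm and vanishes on `dom T`.
  let φ : A.adjoint.domain →ₗ[ℂ] ℂ :=
    { toFun := fun f => F f x - s * (inner ℂ (T g) (f : H) - inner ℂ (g : H) (A.adjoint f))
      map_add' := fun f g => by
        simp [LinearPMap.map_add]
        ring
      map_smul' := fun a f => by
        simp [LinearPMap.map_smul]
        ring }
  have hφ : ∀ f, φ f = F f x - s * (inner ℂ (T g) (f : H) - inner ℂ (g : H) (A.adjoint f)) :=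
    fun f => rfl
  have hzero : φ = 0 := by
    refine eq_zero_of_eq_zero_on_domain hT (c := c * ‖x‖ + ‖s‖ * (‖T g‖ + ‖(g : H)‖))
      (fun f => ?_) fun u v huv => ?_
    · have h₁ : ‖F f x‖ ≤ c * (‖(f : H)‖ + ‖A.adjoint f‖) * ‖x‖ :=
        ((F f).le_opNorm x).trans (by gcongr; exact hc f)
      calc ‖φ f‖ ≤ c * (‖(f : H)‖ + ‖A.adjoint f‖) * ‖x‖ +
            ‖s‖ * (‖T g‖ * ‖(f : H)‖ + ‖(g : H)‖ * ‖A.adjoint f‖) := by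
            refine (norm_sub_le _ _).trans (add_le_add h₁ ?_)
            rw [norm_mul]
            gcongr
            exact (norm_sub_le _ _).trans
              (add_le_add (norm_inner_le_norm _ _) (norm_inner_le_norm _ _))
        _ ≤ c * (‖(f : H)‖ + ‖A.adjoint f‖) * ‖x‖ +
            ‖s‖ * (‖T g‖ * (‖(f : H)‖ + ‖A.adjoint f‖) +
              ‖(g : H)‖ * (‖(f : H)‖ + ‖A.adjoint f‖)) := by
            gcongr <;> simp
        _ = _ := by ring
    · obtain ⟨v', hv', hTv'⟩ := exists_adjoint_eq_of_domain hT u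
      obtain rfl : v' = v := Subtype.ext (hv'.trans huv)
      rw [hφ, hF.extends_map u v' huv, toAntiDual_apply, hx, hG u g hg, hTv', hv', sub_self]
  exact sub_eq_zero.1 ((hφ f).symm.trans (LinearMap.congr_fun hzero f))

end ContinuousExtension

end QBT

/-! ### The extended `γ`-field as an adjoint. -/

namespace QBT

open LinRel

theorem mem_defect {H : Type*} [NormedAddCommGroup H] [InnerProductSpace ℂ H]
    {B : H →ₗ.[ℂ] H} {z : ℂ} {u : B.domain} :
    u ∈ defect B z ↔ B u = z • (u : H) := by
  rw [defect, LinearMap.mem_ker, LinearMap.sub_apply, sub_eq_zero]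
  rfl

section GammaField

open ComplexConjugate

variable {H : Type*} [NormedAddCommGroup H] [InnerProductSpace ℂ H] [CompleteSpace H]
variable {G : Type*} [NormedAddCommGroup G] [InnerProductSpace ℂ G]
variable {X : Type*} [NormedAddCommGroup X] [NormedSpace ℂ X]
variable {A T : H →ₗ.[ℂ] H} {Γ Δ : T.domain →ₗ[ℂ] G} {j : X →L[ℂ] G}

/-- The kernel of the extension of `Γ` is the domain of `T ↾ ker Γ`. -/
theorem IsContinuousExtension.exists_of_apply_eq_zero
    (hT : T.graph.topologicalClosure = A.adjoint.graph) (hG : GreenOnKer Γ Δ 1)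
    (hsa : IsSelfAdjoint (kerRestrict T Γ)) (hj : IsAdmissibleNorm Δ Γ j)
    {F : A.adjoint.domain →ₗ[ℂ] AntiDual X} (hF : IsContinuousExtension A Γ j F)
    {f : A.adjoint.domain} (hf : F f = 0) :
    ∃ u : T.domain, Γ u = 0 ∧ (u : H) = f ∧ T u = A.adjoint f := by
  -- With `F f = 0` the extended Green identity puts `f` in the domain of the adjoint of the
  -- self-adjoint restriction.
  refine exists_of_isSelfAdjoint hsa fun v hv => ?_
  have hx : Δ v ∈ LinearMap.range (j : X →ₗ[ℂ] G) := hj.range_eq ▸ ⟨v, hv, rfl⟩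
  obtain ⟨x, hx⟩ := hx
  have := hF.apply_eq hT hG hv hx f
  rw [hf, zero_apply, one_mul] at this
  rw [← inner_conj_symm, ← inner_conj_symm (f : H), sub_eq_zero.1 this.symm]

/-- `A` is contained in the restriction of `T` to `ker Γ ∩ ker Δ`. -/
theorem exists_eq_of_minimal_domain (hA : Dense (A.domain : Set H))
    (hT : T.graph.topologicalClosure = A.adjoint.graph)
    (hsa : IsSelfAdjoint (kerRestrict T Γ)) (hG : GreenOnKer Γ Δ 1) (hΓ : DenseRange Γ)
    (v : A.domain) : ∃ u : T.domain, Γ u = 0 ∧ Δ u = 0 ∧ (u : H) = v ∧ T u = A v := by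
  have hadj := LinearPMap.adjoint_isFormalAdjoint hA
  obtain ⟨u, hu, huv, hTu⟩ := exists_of_isSelfAdjoint hsa (f := (v : H)) (k := A v) (by
    intro w _
    obtain ⟨w', hw', hTw'⟩ := exists_adjoint_eq_of_domain hT w
    rw [← hw', ← hTw']
    exact (hadj.symm v w'))
  refine ⟨u, hu, ?_, huv, hTu⟩
  -- By Green's identity `Δ u` is orthogonal to the dense range of `Γ`.
  refine hΓ.eq_of_inner_left ℂ fun f => ?_
  obtain ⟨f', hf', hTf'⟩ := exists_adjoint_eq_of_domain hT f
  rw [hG f u hu, ← hf', ← hTf', huv, hTu, inner_zero_left, hadj.symm v f', sub_self, mul_zero]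

/-- `γ` is the bounded operator from `X'` to `H` whose adjoint is `S`. -/
def IsAdjointOf (γ : AntiDual X →L[ℂ] H) (S : H →L[ℂ] X) : Prop :=
  ∀ (h : H) (x' : AntiDual X), inner ℂ h (γ x') = x' (S h)

/-- The isomorphisms turn the duality pairing into the inner product of `G`, so `γ = (ι₊ S)* ι₋`
with a Hilbert space adjoint. Taking adjoints turns a right inverse of `ι₊ S` into a left inverse of
`(ι₊ S)*`. -/
theorem exists_isAdjointOf [CompleteSpace G] (ιp : X ≃L[ℂ] G) (ιm : AntiDual X ≃L[ℂ] G)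
    (hι : ∀ (x : X) (x' : AntiDual X), inner ℂ (ιp x) (ιm x') = x' x) {S : H →L[ℂ] X}
    (hS : S.HasRightInverse) :
    ∃ γ : AntiDual X →L[ℂ] H, IsAdjointOf γ S ∧ ∃ δ : H →L[ℂ] G, ∀ x', δ (γ x') = ιm x' := by
  obtain ⟨S', hS'⟩ := hS
  let P : H →L[ℂ] G := (ιp : X →L[ℂ] G) ∘L S
  let Q : G →L[ℂ] H := S' ∘L (ιp.symm : G →L[ℂ] X)
  have hPQ : ∀ a, P (Q a) = a := by
    intro a
    change ιp (S (S' (ιp.symm a))) = a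
    rw [hS', ιp.apply_symm_apply]
  refine ⟨P.adjoint ∘L (ιm : AntiDual X →L[ℂ] G), fun h x' => ?_, Q.adjoint, fun x' => ?_⟩
  · rw [ContinuousLinearMap.comp_apply, ContinuousLinearMap.adjoint_inner_right]
    exact hι _ _
  · refine ext_inner_left ℂ fun a => ?_
    change inner ℂ a (Q.adjoint (P.adjoint (ιm x'))) = _
    rw [ContinuousLinearMap.adjoint_inner_right, ContinuousLinearMap.adjoint_inner_right, hPQ]

/-- For `u ∈ ker Γ` and `j x = Δ u`, duality gives `(γ x', (T - z̄) u) = ⟨x', x⟩` up to the order of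
the arguments. On `dom A` both boundary values vanish, so `γ x' ∈ ker (A* - z)`; for general `u`,
comparison with Green's identity identifies the boundary value of `γ x'` as `x'`. -/
theorem IsAdjointOf.exists_defect (hA : Dense (A.domain : Set H))
    (hT : T.graph.topologicalClosure = A.adjoint.graph)
    (hsa : IsSelfAdjoint (kerRestrict T Γ)) (hG : GreenOnKer Γ Δ 1) (hΓ : DenseRange Γ)
    (hj : IsAdmissibleNorm Δ Γ j) {F : A.adjoint.domain →ₗ[ℂ] AntiDual X}
    (hF : IsContinuousExtension A Γ j F) {z : ℂ} {S : H →L[ℂ] X}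
    (hS : IsTraceResolvent Δ Γ j (conj z) S) {γ : AntiDual X →L[ℂ] H} (hγ : IsAdjointOf γ S)
    (x' : AntiDual X) :
    ∃ u : A.adjoint.domain, (u : H) = γ x' ∧ A.adjoint u = z • (u : H) ∧ F u = x' := by
  have key : ∀ (u : T.domain) (x : X), Γ u = 0 → j x = Δ u →
      inner ℂ (T u) (γ x') - z * inner ℂ (u : H) (γ x') = x' x := by
    intro u x hu hx
    have := hγ (T u - conj z • (u : H)) x'
    rw [hj.injective ((hS u hu).trans hx.symm), inner_sub_left, inner_smul_left] at this
    simpa using this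
  obtain ⟨u, hu, hAu⟩ := LinearPMap.exists_adjoint_apply_eq hA (f := γ x') (k := z • γ x') (by
    intro v
    obtain ⟨t, ht, ht', htv, hTt⟩ := exists_eq_of_minimal_domain hA hT hsa hG hΓ v
    -- Here `x = 0`, because `Δ t = 0`.
    have := key t 0 ht (by rw [map_zero, ht'])
    rw [map_zero, sub_eq_zero, htv, hTt] at this
    rw [← inner_conj_symm, ← inner_conj_symm (γ x'), this, inner_smul_right])
  refine ⟨u, hu, by rw [hAu, hu], ?_⟩
  ext x
  have hx : j x ∈ ranOnKer Δ Γ := hj.range_eq ▸ ⟨x, rfl⟩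
  obtain ⟨g, hg, hgx⟩ := hx
  rw [hF.apply_eq hT hG hg hgx.symm, hAu, hu, one_mul, inner_smul_right]
  exact key g x hg hgx.symm

end GammaField

/-! ### Krein's formula for the extensions `Ã_ϑ`. -/

section Krein

variable {H : Type*} [NormedAddCommGroup H] [InnerProductSpace ℂ H] [CompleteSpace H]
variable {G : Type*} [NormedAddCommGroup G] [InnerProductSpace ℂ G]
variable {X₀ : Type*} [NormedAddCommGroup X₀] [NormedSpace ℂ X₀]
variable {X₁ : Type*} [NormedAddCommGroup X₁] [NormedSpace ℂ X₁]
variable {A T : H →ₗ.[ℂ] H} {Γ₀ Γ₁ : T.domain →ₗ[ℂ] G} {j₀ : X₀ →L[ℂ] G} {j₁ : X₁ →L[ℂ] G}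
  {F₀ : A.adjoint.domain →ₗ[ℂ] AntiDual X₁} {F₁ : A.adjoint.domain →ₗ[ℂ] AntiDual X₀}
  {z : ℂ} {R : H →L[ℂ] H} {S : H →L[ℂ] X₁} {γ : AntiDual X₁ →L[ℂ] H}

/-- The operators `R = (A₀ - z)⁻¹`, `S = Γ₁ R` and `γ = (F₀ ↾ ker (A* - z))⁻¹`, for the extended
boundary maps `F₀` and `F₁`. -/
structure IsGammaPair (A : H →ₗ.[ℂ] H) {T : H →ₗ.[ℂ] H} (Γ₀ Γ₁ : T.domain →ₗ[ℂ] G)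
    (j₀ : X₀ →L[ℂ] G) (j₁ : X₁ →L[ℂ] G)
    (F₀ : A.adjoint.domain →ₗ[ℂ] AntiDual X₁) (F₁ : A.adjoint.domain →ₗ[ℂ] AntiDual X₀)
    (z : ℂ) (R : H →L[ℂ] H) (S : H →L[ℂ] X₁) (γ : AntiDual X₁ →L[ℂ] H) : Prop where
  closure_eq : T.graph.topologicalClosure = A.adjoint.graph
  injective : Function.Injective fun x : X₁ => toAntiDual j₀ (j₁ x)
  extends₀ : IsContinuousExtension A Γ₀ j₁ F₀
  extends₁ : IsContinuousExtension A Γ₁ j₀ F₁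
  exists_of_apply_eq_zero : ∀ f : A.adjoint.domain, F₀ f = 0 →
    ∃ u : T.domain, Γ₀ u = 0 ∧ (u : H) = f ∧ T u = A.adjoint f
  resolvent : IsResolvent Γ₀ z R
  trace : IsTraceResolvent Γ₁ Γ₀ j₁ z S
  exists_defect : ∀ x', ∃ u : A.adjoint.domain,
    (u : H) = γ x' ∧ A.adjoint u = z • (u : H) ∧ F₀ u = x'

namespace IsGammaPair

variable (D : IsGammaPair A Γ₀ Γ₁ j₀ j₁ F₀ F₁ z R S γ)
include D

/-- The decomposition `f = (A₀ - z)⁻¹ (A* - z) f + γ F₀ f`. -/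
theorem decomposition (f : A.adjoint.domain) :
    (f : H) = R (A.adjoint f - z • (f : H)) + γ (F₀ f) ∧
      ∀ u : A.adjoint.domain, (u : H) = γ (F₀ f) →
        F₁ f = F₁ u + toAntiDual j₀ (j₁ (S (A.adjoint f - z • (f : H)))) := by
  obtain ⟨u, hu, hAu, hFu⟩ := D.exists_defect (F₀ f)
  -- Subtracting the defect element with the same boundary value leaves a vector in `dom A₀`.
  obtain ⟨t, ht, htf, hTt⟩ := D.exists_of_apply_eq_zero (f - u) (by rw [map_sub, hFu, sub_self])
  have hTt' : T t - z • (t : H) = A.adjoint f - z • (f : H) := by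
    rw [hTt, htf, LinearPMap.map_sub, hAu, Submodule.coe_sub]
    module
  constructor
  · have := D.resolvent.apply t ht
    rw [← hTt', this, htf, Submodule.coe_sub, hu, sub_add_cancel]
  · intro v hv
    obtain rfl : u = v := Subtype.ext (hu.trans hv.symm)
    rw [← hTt', D.trace t ht, ← D.extends₁.extends_map t (f - u) htf, ← map_add,
      add_sub_cancel]

theorem eq_gamma {u : A.adjoint.domain} (hu : A.adjoint u = z • (u : H)) :
    (u : H) = γ (F₀ u) := by
  have := (D.decomposition u).1
  rwa [hu, sub_self, map_zero, zero_add] at this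

theorem mem_gammaField {x' : AntiDual X₁} {f : H} :
    (x', f) ∈ gammaField A.adjoint F₀ z ↔ f = γ x' := by
  constructor
  · rintro ⟨u, hu, huf⟩
    obtain ⟨rfl, rfl⟩ := Prod.mk.inj huf
    exact D.eq_gamma (mem_defect.1 hu)
  · rintro rfl
    obtain ⟨u, hu, hAu, hFu⟩ := D.exists_defect x'
    exact ⟨u, mem_defect.2 hAu, Prod.ext hFu hu⟩

theorem mem_adj {S' : H →L[ℂ] X₁} (hγ : IsAdjointOf γ S') {h : H} {x : X₁} :
    (h, x) ∈ adj (gammaField A.adjoint F₀ z) ↔ x = S' h := by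
  constructor
  · intro hx
    have hx' : ∀ x' : AntiDual X₁, x' x = x' (S' h) := fun x' =>
      (hx (x', γ x') (D.mem_gammaField.2 rfl)).trans (hγ h x')
    -- The functionals induced by elements of `G` already separate points.
    have : j₁ x = j₁ (S' h) := ext_inner_right ℂ fun g => hx' (toAntiDual j₁ g)
    exact D.injective (congrArg (toAntiDual j₀) this)
  · rintro rfl ⟨x', f⟩ hq
    obtain rfl := D.mem_gammaField.1 hq
    exact (hγ h x').symm

variable {ϑ : Submodule ℂ (AntiDual X₁ × AntiDual X₀)}

/-- Since `ϑ` lies in the range of the boundary maps, each of its pairs is `(F₀ f, F₁ f)` for some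
`f`. Subtracting the Weyl function at `F₀ f` leaves the regular part `S (A* - z) f`, which lies in
`X₁`. -/
theorem mem_toRegular (hϑ : ϑ ≤ LinearMap.range (F₀.prod F₁)) {x' : AntiDual X₁} {x : X₁} :
    (x', x) ∈ toRegular j₀ j₁ (sub ϑ (weylFunction A.adjoint F₀ F₁ z)) ↔
      ∃ f : A.adjoint.domain, (F₀ f, F₁ f) ∈ ϑ ∧ F₀ f = x' ∧
        S (A.adjoint f - z • (f : H)) = x := by
  constructor
  · rintro ⟨y, y', hy, ⟨u, hu, huy⟩, hyy⟩
    obtain ⟨f, hf⟩ := hϑ hy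
    obtain ⟨hf₀, hf₁⟩ := Prod.mk.inj hf
    obtain ⟨hu₀, hu₁⟩ := Prod.mk.inj huy
    refine ⟨f, ?_, hf₀, D.injective ?_⟩
    · rw [hf₀, hf₁]
      exact hy
    · have h₁ := (D.decomposition f).2 u (by
        rw [D.eq_gamma (mem_defect.1 hu)]
        exact congrArg γ (hu₀.trans hf₀.symm))
      have h₂ : toAntiDual j₀ (j₁ x) = y - y' := hyy
      change toAntiDual j₀ (j₁ _) = toAntiDual j₀ (j₁ x)
      rw [h₂, ← hf₁, ← hu₁, h₁, add_sub_cancel_left]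
  · rintro ⟨f, hf, rfl, rfl⟩
    obtain ⟨u, hu, hAu, hFu⟩ := D.exists_defect (F₀ f)
    refine ⟨F₁ f, F₁ u, hf, ⟨u, mem_defect.2 hAu, Prod.ext hFu rfl⟩, ?_⟩
    rw [(D.decomposition f).2 u hu, add_sub_cancel_left]
    rfl

/-- The decomposition gives one direction. For the other, a `g` with boundary values in `ϑ` and `S
(A* - z) g = S h` is replaced by `R h + γ (F₀ g)`, which has the same boundary values and is mapped
to `h` by `A* - z`. -/
theorem mem_subScalar_extension (hϑ : ϑ ≤ LinearMap.range (F₀.prod F₁)) {f h : H} :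
    (f, h) ∈ subScalar (extension A.adjoint F₀ F₁ ϑ).graph z ↔
      ∃ x', (x', S h) ∈ toRegular j₀ j₁ (sub ϑ (weylFunction A.adjoint F₀ F₁ z)) ∧
        f = R h + γ x' := by
  rw [mem_subScalar, extension, LinearPMap.mem_graph_domRestrict_map]
  simp only [D.mem_toRegular hϑ]
  constructor
  · rintro ⟨u, hu, rfl, hAu⟩
    have hh : A.adjoint u - z • (u : H) = h := by rw [hAu, add_sub_cancel_right]
    refine ⟨F₀ u, ⟨u, hu, rfl, by rw [hh]⟩, ?_⟩
    rw [← hh]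
    exact (D.decomposition u).1
  · rintro ⟨_, ⟨g, hg, rfl, hgS⟩, rfl⟩
    obtain ⟨t, ht, htR, hTt⟩ := D.resolvent.exists_eq h
    obtain ⟨v, hv, hAv⟩ := exists_adjoint_eq_of_domain D.closure_eq t
    obtain ⟨u, hu, hAu, hFu⟩ := D.exists_defect (F₀ g)
    have hF₀ : F₀ (v + u) = F₀ g := by
      rw [map_add, D.extends₀.extends_map t v hv.symm, ht, map_zero, zero_add, hFu]
    have hA : A.adjoint (v + u) = h + z • (R h + γ (F₀ g)) := by
      rw [LinearPMap.map_add, hAv, hTt, hAu, hu, smul_add, add_assoc]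
    have hcoe : ((v + u : A.adjoint.domain) : H) = R h + γ (F₀ g) := by
      rw [Submodule.coe_add, hv, htR, hu]
    -- By the decomposition, `F₁` depends only on `F₀` and on `S (A* - z)`, and both agree for `v +
    -- u` and `g`.
    have hF₁ : F₁ (v + u) = F₁ g := by
      rw [(D.decomposition (v + u)).2 u (by rw [hF₀, hu]), (D.decomposition g).2 u hu, hgS, hA,
        hcoe, add_sub_cancel_right]
    refine ⟨v + u, ?_, hcoe, hA⟩
    change (F₀ (v + u), F₁ (v + u)) ∈ ϑ
    rwa [hF₀, hF₁]

/-- The case `h = 0` of the preceding equivalence; restricting the values to `X₁` does not change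
the kernel. -/
theorem ker_subScalar_extension (hϑ : ϑ ≤ LinearMap.range (F₀.prod F₁)) :
    ker (subScalar (extension A.adjoint F₀ F₁ ϑ).graph z) =
      image (gammaField A.adjoint F₀ z) (ker (sub ϑ (weylFunction A.adjoint F₀ F₁ z))) := by
  have hker : ∀ x', (x', (0 : X₁)) ∈ toRegular j₀ j₁ (sub ϑ (weylFunction A.adjoint F₀ F₁ z)) ↔
      x' ∈ ker (sub ϑ (weylFunction A.adjoint F₀ F₁ z)) := by
    intro x'
    change (x', toAntiDual j₀ (j₁ 0)) ∈ sub ϑ (weylFunction A.adjoint F₀ F₁ z) ↔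
      (x', 0) ∈ sub ϑ (weylFunction A.adjoint F₀ F₁ z)
    rw [map_zero, map_zero]
  ext f
  refine (D.mem_subScalar_extension hϑ).trans ?_
  change (∃ x', (x', S 0) ∈ _ ∧ f = R 0 + γ x') ↔ _
  simp only [map_zero, zero_add, hker]
  constructor
  · rintro ⟨x', hx', rfl⟩
    exact ⟨(x', γ x'), ⟨D.mem_gammaField.2 rfl, hx'⟩, rfl⟩
  · rintro ⟨⟨x', g⟩, ⟨hg, hx'⟩, rfl⟩
    exact ⟨x', hx', D.mem_gammaField.1 hg⟩

/-- Krein's formula, as an equality of linear relations. -/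
theorem inv_subScalar_extension (hϑ : ϑ ≤ LinearMap.range (F₀.prod F₁))
    {w : ℂ} {R' : H →L[ℂ] H} {S' : H →L[ℂ] X₁} {γ' : AntiDual X₁ →L[ℂ] H}
    (D' : IsGammaPair A Γ₀ Γ₁ j₀ j₁ F₀ F₁ w R' S' γ') (hγ' : IsAdjointOf γ' S) :
    inv (subScalar (extension A.adjoint F₀ F₁ ϑ).graph z) =
      add (inv (subScalar (kerRestrict T Γ₀).graph z))
        (comp (gammaField A.adjoint F₀ z)
          (comp (inv (toRegular j₀ j₁ (sub ϑ (weylFunction A.adjoint F₀ F₁ z))))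
            (adj (gammaField A.adjoint F₀ w)))) := by
  ext ⟨h, f⟩
  refine (D.mem_subScalar_extension hϑ).trans ?_
  have hres : inv (subScalar (kerRestrict T Γ₀).graph z) = LinearMap.graph (R : H →ₗ[ℂ] H) :=
    D.resolvent
  rw [hres]
  constructor
  · rintro ⟨x', hx', hf⟩
    exact ⟨R h, γ x', rfl, ⟨x', ⟨S h, (D'.mem_adj hγ').2 rfl, hx'⟩, D.mem_gammaField.2 rfl⟩, hf⟩
  · rintro ⟨y, y', hy, ⟨x', ⟨x, hx, hx'⟩, hy'⟩, hf⟩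
    obtain rfl : y = R h := hy
    obtain rfl := (D'.mem_adj hγ').1 hx
    obtain rfl := D.mem_gammaField.1 hy'
    exact ⟨x', hx', hf⟩

end IsGammaPair

theorem mem_conjugate {ιp : X₁ ≃L[ℂ] G} {ιm : AntiDual X₁ ≃L[ℂ] G}
    {Θ : Submodule ℂ (AntiDual X₁ × X₁)} {x' : AntiDual X₁} {x : X₁} :
    (ιm x', ιp x) ∈ conjugate ιp ιm Θ ↔ (x', x) ∈ Θ := by
  constructor
  · rintro ⟨y, ⟨y', hy', hΘ⟩, hy⟩
    obtain rfl := ιm.injective (show ιm x' = ιm y' from hy')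
    obtain rfl := ιp.injective (show ιp x = ιp y from hy)
    exact hΘ
  · intro h
    exact ⟨x, ⟨x', rfl, h⟩, rfl⟩

end Krein

end QBT

/-! ### Assembly of the main theorem. -/

namespace QBT

open LinRel

theorem subScalar_zero {X : Type*} [AddCommGroup X] [Module ℂ X] (R : Submodule ℂ (X × X)) :
    subScalar R 0 = R := by
  ext ⟨x, y⟩
  rw [mem_subScalar, zero_smul, add_zero]

theorem IsContinuousExtension.extendedMap {H : Type*} [NormedAddCommGroup H]
    [InnerProductSpace ℂ H] [CompleteSpace H] {G : Type*} [NormedAddCommGroup G]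
    [InnerProductSpace ℂ G] {X : Type*} [NormedAddCommGroup X] [NormedSpace ℂ X]
    {A T : H →ₗ.[ℂ] H} {Γ : T.domain →ₗ[ℂ] G} {j : X →L[ℂ] G}
    (h : ∃ F, IsContinuousExtension A Γ j F) :
    IsContinuousExtension A Γ j (QBT.extendedMap A Γ j) := by
  rw [QBT.extendedMap, dif_pos h]
  exact h.choose_spec

end QBT

open LinRel QBT in
theorem mainTheorem8
    {H : Type*} [NormedAddCommGroup H] [InnerProductSpace ℂ H] [CompleteSpace H]
    {G : Type*} [NormedAddCommGroup G] [InnerProductSpace ℂ G] [CompleteSpace G]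
    -- the symmetric operator `A` and the quasi boundary triple `(G, Γ₀, Γ₁)` for `T ⊆ A*`
    (A T : H →ₗ.[ℂ] H) (hAclosed : A.IsClosed) (hAdense : Dense (A.domain : Set H))
    (hAsymm : A ≤ A.adjoint)
    (Γ₀ Γ₁ : T.domain →ₗ[ℂ] G) (hΓ : QBT.IsQuasiBoundaryTriple A T Γ₀ Γ₁)
    (hA₁ : IsSelfAdjoint (QBT.kerRestrict T Γ₁))
    (hη : ∃ η : ℝ, (η : ℂ) ∈ LinRel.resolventSet (QBT.kerRestrict T Γ₀).graph)
    (hG₀ : Dense (QBT.ranOnKer Γ₀ Γ₁ : Set G)) (hG₁ : Dense (QBT.ranOnKer Γ₁ Γ₀ : Set G))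
    -- `X₀`, `X₁` are the spaces `𝒢₀`, `𝒢₁` with admissible norms, `j₀`, `j₁` the embeddings in `G`
    {X₀ : Type*} [NormedAddCommGroup X₀] [NormedSpace ℂ X₀] (j₀ : X₀ →L[ℂ] G)
    (hj₀ : QBT.IsAdmissibleNorm Γ₀ Γ₁ j₀)
    {X₁ : Type*} [NormedAddCommGroup X₁] [NormedSpace ℂ X₁] (j₁ : X₁ →L[ℂ] G)
    (hj₁ : QBT.IsAdmissibleNorm Γ₁ Γ₀ j₁)
    -- the isomorphisms `ι₊ : 𝒢₁ → G` and `ι₋ : 𝒢₁' → G` of the Gelfand triple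
    (ιp : X₁ ≃L[ℂ] G) (ιm : QBT.AntiDual X₁ ≃L[ℂ] G)
    (hι : ∀ (x : X₁) (x' : QBT.AntiDual X₁), inner ℂ (ιp x) (ιm x') = x' x)
    -- the extended boundary maps on `dom A*`
    (Γt₀ : A.adjoint.domain →ₗ[ℂ] QBT.AntiDual X₁) (hΓt₀ : Γt₀ = QBT.extendedMap A Γ₀ j₁)
    (Γt₁ : A.adjoint.domain →ₗ[ℂ] QBT.AntiDual X₀) (hΓt₁ : Γt₁ = QBT.extendedMap A Γ₁ j₀) :
    -- the continuous extensions exist and are unique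
    (∃! F, QBT.IsContinuousExtension A Γ₀ j₁ F) ∧
    (∃! F, QBT.IsContinuousExtension A Γ₁ j₀ F) ∧
    ∀ ϑ : Submodule ℂ (QBT.AntiDual X₁ × QBT.AntiDual X₀),
      ϑ ≤ LinearMap.range (Γt₀.prod Γt₁) →
      (QBT.extension A.adjoint Γt₀ Γt₁ ϑ).IsClosed →
      ∀ z ∈ LinRel.resolventSet (QBT.kerRestrict T Γ₀).graph,
        -- (i)
        ((z ∈ LinRel.pointSpectrum (QBT.extension A.adjoint Γt₀ Γt₁ ϑ).graph ↔
            0 ∈ LinRel.pointSpectrum (QBT.conjugate ιp ιm (QBT.toRegular j₀ j₁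
              (LinRel.sub ϑ (QBT.weylFunction A.adjoint Γt₀ Γt₁ z))))) ∧
          (z ∈ LinRel.pointSpectrum (QBT.extension A.adjoint Γt₀ Γt₁ ϑ).graph →
            LinRel.ker (LinRel.subScalar (QBT.extension A.adjoint Γt₀ Γt₁ ϑ).graph z) =
              LinRel.image (QBT.gammaField A.adjoint Γt₀ z)
                (LinRel.ker (LinRel.sub ϑ (QBT.weylFunction A.adjoint Γt₀ Γt₁ z))))) ∧
        -- (ii)
        (z ∈ LinRel.continuousSpectrum (QBT.extension A.adjoint Γt₀ Γt₁ ϑ).graph ↔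
          0 ∈ LinRel.continuousSpectrum (QBT.conjugate ιp ιm (QBT.toRegular j₀ j₁
            (LinRel.sub ϑ (QBT.weylFunction A.adjoint Γt₀ Γt₁ z))))) ∧
        -- (iii)
        (z ∈ LinRel.residualSpectrum (QBT.extension A.adjoint Γt₀ Γt₁ ϑ).graph ↔
          0 ∈ LinRel.residualSpectrum (QBT.conjugate ιp ιm (QBT.toRegular j₀ j₁
            (LinRel.sub ϑ (QBT.weylFunction A.adjoint Γt₀ Γt₁ z))))) ∧
        -- (iv)
        ((z ∈ LinRel.resolventSet (QBT.extension A.adjoint Γt₀ Γt₁ ϑ).graph ↔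
            0 ∈ LinRel.resolventSet (QBT.conjugate ιp ιm (QBT.toRegular j₀ j₁
              (LinRel.sub ϑ (QBT.weylFunction A.adjoint Γt₀ Γt₁ z))))) ∧
          (z ∈ LinRel.resolventSet (QBT.extension A.adjoint Γt₀ Γt₁ ϑ).graph →
            LinRel.inv (LinRel.subScalar (QBT.extension A.adjoint Γt₀ Γt₁ ϑ).graph z) =
              LinRel.add
                (LinRel.inv (LinRel.subScalar (QBT.kerRestrict T Γ₀).graph z))
                (LinRel.comp (QBT.gammaField A.adjoint Γt₀ z)
                  (LinRel.comp
                    (LinRel.inv (QBT.toRegular j₀ j₁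
                      (LinRel.sub ϑ (QBT.weylFunction A.adjoint Γt₀ Γt₁ z))))
                    (QBT.adj (QBT.gammaField A.adjoint Γt₀ (starRingEnd ℂ z))))))) := by

  have hT := hΓ.closure_eq
  have hG01 : GreenOnKer Γ₀ Γ₁ 1 := by
    intro f g hg
    have := hΓ.green f g
    rw [hg, inner_zero_left] at this
    linear_combination this
  have hG10 : GreenOnKer Γ₁ Γ₀ (-1) := by
    intro f g hg
    have := hΓ.green f g
    rw [hg, inner_zero_left] at this
    linear_combination -this
  have hΓ₀ : DenseRange Γ₀ :=
    Prod.fst_surjective.denseRange.comp hΓ.denseRange continuous_fst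
  have hex₀ : ∃ F, IsContinuousExtension A Γ₀ j₁ F := by
    obtain ⟨z, ⟨R, hR⟩, -⟩ := hj₁.continuous
    exact exists_isContinuousExtension hT hG01 hj₁ (hR : IsResolvent Γ₀ z R)
  have hex₁ : ∃ F, IsContinuousExtension A Γ₁ j₀ F := by
    obtain ⟨z, ⟨R, hR⟩, -⟩ := hj₀.continuous
    exact exists_isContinuousExtension hT hG10 hj₀ (hR : IsResolvent Γ₁ z R)
  have hF₀ : IsContinuousExtension A Γ₀ j₁ Γt₀ := hΓt₀ ▸ IsContinuousExtension.extendedMap hex₀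
  have hF₁ : IsContinuousExtension A Γ₁ j₀ Γt₁ := hΓt₁ ▸ IsContinuousExtension.extendedMap hex₁
  refine ⟨⟨Γt₀, hF₀, fun F hF => hF.unique hT hF₀⟩, ⟨Γt₁, hF₁, fun F hF => hF.unique hT hF₁⟩, ?_⟩
  rintro ϑ hϑ - z ⟨R, hR⟩
  have hsa := hΓ.selfAdjoint
  have hinj : Function.Injective fun x : X₁ => toAntiDual j₀ (j₁ x) := by
    refine (toAntiDual_injective ?_).comp hj₁.injective
    have : (ranOnKer Γ₀ Γ₁ : Set G) = Set.range j₀ := by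
      rw [← hj₀.range_eq]
      rfl
    exact this ▸ hG₀
  have hR : IsResolvent Γ₀ z R := hR
  have hR' := hR.adjoint hsa
  obtain ⟨S, hS⟩ := hj₁.exists_isTraceResolvent hR
  obtain ⟨S', hS'⟩ := hj₁.exists_isTraceResolvent hR'
  -- The points are crossed: the `γ`-field at `z` is the adjoint of the trace of the resolvent at
  -- `z̄`, and vice versa.
  obtain ⟨γ, hγ, δ, hδ⟩ := exists_isAdjointOf ιp ιm hι (hS'.hasRightInverse hj₁)
  obtain ⟨γ', hγ', -⟩ := exists_isAdjointOf ιp ιm hι (hS.hasRightInverse hj₁)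
  have D : IsGammaPair A Γ₀ Γ₁ j₀ j₁ Γt₀ Γt₁ z R S γ :=
    ⟨hT, hinj, hF₀, hF₁, fun f hf => hF₀.exists_of_apply_eq_zero hT hG01 hsa hj₁ hf, hR, hS,
      hγ.exists_defect hAdense hT hsa hG01 hΓ₀ hj₁ hF₀ hS'⟩
  have D' : IsGammaPair A Γ₀ Γ₁ j₀ j₁ Γt₀ Γt₁ (starRingEnd ℂ z) R.adjoint S' γ' :=
    ⟨hT, hinj, hF₀, hF₁, fun f hf => hF₀.exists_of_apply_eq_zero hT hG01 hsa hj₁ hf, hR', hS',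
      hγ'.exists_defect hAdense hT hsa hG01 hΓ₀ hj₁ hF₀ (by rwa [Complex.conj_conj])⟩
  obtain ⟨Q, hQ⟩ := hS.hasRightInverse hj₁
  let Θ := toRegular j₀ j₁ (sub ϑ (weylFunction A.adjoint Γt₀ Γt₁ z))
  -- Krein's equivalence carried to `G` by `ι₊` and `ι₋`, in the form required by the transfer
  -- lemmas.
  have hL : ∀ f h, (f, h) ∈ subScalar (extension A.adjoint Γt₀ Γt₁ ϑ).graph z ↔
      ∃ a, (a, ((ιp : X₁ →L[ℂ] G) ∘L S) h) ∈ subScalar (conjugate ιp ιm Θ) 0 ∧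
        f = R h + (γ ∘L (ιm.symm : G →L[ℂ] AntiDual X₁)) a := by
    intro f h
    rw [subScalar_zero, D.mem_subScalar_extension hϑ]
    constructor
    · rintro ⟨x', hx', rfl⟩
      exact ⟨ιm x', mem_conjugate.2 hx', by simp⟩
    · rintro ⟨a, ha, rfl⟩
      obtain ⟨x', rfl⟩ := ιm.surjective a
      exact ⟨x', mem_conjugate.1 ha, by simp⟩
  have hQ' : ∀ a, ((ιp : X₁ →L[ℂ] G) ∘L S) ((Q ∘L (ιp.symm : G →L[ℂ] X₁)) a) = a := by
    intro a
    change ιp (S (Q (ιp.symm a))) = a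
    rw [hQ, ιp.apply_symm_apply]
  have hδ' : ∀ a, δ ((γ ∘L (ιm.symm : G →L[ℂ] AntiDual X₁)) a) = a := fun a =>
    (hδ _).trans (ιm.apply_symm_apply a)
  have hker := ker_eq_bot_iff_of_krein hL (Function.LeftInverse.injective hδ')
  have hran := dense_ran_iff_of_krein hL hQ'
  have hres : z ∈ resolventSet (extension A.adjoint Γt₀ Γt₁ ϑ).graph ↔
      0 ∈ resolventSet (conjugate ιp ιm Θ) := exists_inv_eq_graph_iff_of_krein hL hQ' hδ'
  exact ⟨⟨hker.not, fun _ => D.ker_subScalar_extension hϑ⟩,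
    and_congr hker (and_congr hran hres.not), and_congr hker hran.not,
    hres, fun _ => D.inv_subScalar_extension hϑ D' hγ'⟩
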